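/- All logarithms are to base 2. Let $\mathcal M$ be the class of monotonic probability distributions $\theta=(\theta_1\ge\theta_2\ge\cdots)$ on the positive integers. For a binary prefix code for the sequences $x^n$ of $n$ positive integers, with length function $L$ (in bits), and for $X^n$ drawn i.i.d. from $\theta$, let $$R_n(L,\theta)=\frac1n E_\theta L(X^n)-H_\theta(X)$$ be the per-symbol redundancy, where $H_\theta(X)$ is the entropy of $\theta$ in bits. Statement: there is a sequence of binary prefix codes, one for every block length $n$, with length functions $L^*=L^*_n$ that depend only on $n$ (not on the distribution, nor on $p$ or $\varepsilon$ below), such that (1) the codes are universal for $\mathcal M$: for every $\theta\in\mathcal M$ with $H_\theta(X)<\infty$, the expected length $E_\theta L^*(X^n)$ is finite for every $n$, and $R_n(L^*,\theta)\to0$ as $n\to\infty$; (2) for every $0<p<1$, the geometric distribution $\theta_i=p(1-p)^{i-1}$, $i=1,2,\dots$, has finite entropy, the expected lengths $E_\theta L^*(X^n)$ are finite, and for every $\varepsilon>0$ there is $n_0=n_0(p,\varepsilon)$ such that for all $n\ge n_0$ $$R_n(L^*,\theta)\le\frac{1+\varepsilon}{-2\log(1-p)}\cdot\frac{(\log n)^2}{n}.$$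 Moreover, for every $0<p<1$, the geometric distribution has the effective alphabet size $m^*=m^*_n=\dfrac{\log n}{-\log(1-p)}=O(\log n)$. This means that $m^*=o(n^{1/3})$, that $\sum_i\theta_i\log i<\infty$, and that the cost of the symbols beyond $m^*$ is negligible with respect to the redundancy of an alphabet of size $m^*$: $$\sum_{i>m^*}n\,\theta_i\log i=o\!\left(\frac{m^*-1}{2}\log\frac{n}{(m^*)^3}\right)\qquad(n\to\infty).$$ -/

import Mathlib

open MeasureTheory Filter Topology Asymptotics

/-- The class of monotonic distributions over the positive integers:
`θ 1 ≥ θ 2 ≥ ⋯`. Distributions over `{1, …, k}` are the ones that vanish beyond `k`. -/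
def monotonicDistributions : Set (PMF ℕ+) := {θ | Antitone θ}

/-- A binary prefix code for sequences of `n` positive integers: no codeword is a prefix of the
codeword of another sequence (in particular distinct sequences have distinct codewords). -/
structure BlockCode (n : ℕ) where
  encode : (Fin n → ℕ+) → List Bool
  prefixFree : ∀ x y : Fin n → ℕ+, encode x <+: encode y → x = y

/-- The length function of a code, in bits. -/
def BlockCode.len {n : ℕ} (C : BlockCode n) (x : Fin n → ℕ+) : ℝ := ((C.encode x).length : ℝ)

/-- The discrete σ-algebra on the alphabet. -/
instance instMeasurableSpacePNatDiscrete : MeasurableSpace ℕ+ := ⊤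

instance instDiscreteMeasurableSpacePNat : DiscreteMeasurableSpace ℕ+ := ⟨fun _ => trivial⟩

/-- The law of `n` independent symbols drawn from `θ`. -/
noncomputable def iidLaw (θ : PMF ℕ+) (n : ℕ) : Measure (Fin n → ℕ+) :=
  Measure.pi fun _ => θ.toMeasure

/-- The entropy series of `θ` converges. -/
def FiniteEntropy (θ : PMF ℕ+) : Prop :=
  Summable fun i : ℕ+ => Real.negMulLog (θ i).toReal

/-- The entropy of `θ`, in bits. -/
noncomputable def entropyBits (θ : PMF ℕ+) : ℝ :=
  (∑' i : ℕ+, Real.negMulLog (θ i).toReal) / Real.log 2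

/-- The expected length of the code is finite. -/
def BlockCode.FiniteMeanLength {n : ℕ} (C : BlockCode n) (θ : PMF ℕ+) : Prop :=
  Integrable C.len (iidLaw θ n)

/-- The average per-symbol redundancy `R_n(L, θ) = (1/n) E_θ L(X^n) - H_θ(X)`. It is used only
together with `FiniteEntropy θ` and `C.FiniteMeanLength θ`. -/
noncomputable def BlockCode.redundancy {n : ℕ} (C : BlockCode n) (θ : PMF ℕ+) : ℝ :=
  (1 / (n : ℝ)) * (∫ x, C.len x ∂(iidLaw θ n)) - entropyBits θ

/-- A sequence of codes, one for each block length, is universal for the class of monotonic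
distributions if its per-symbol redundancy vanishes for every monotonic distribution of finite
entropy. The codes depend on the block length only, not on the distribution. -/
def IsUniversalMonotonic (C : ∀ n : ℕ, BlockCode n) : Prop :=
  ∀ θ ∈ monotonicDistributions, FiniteEntropy θ →
    (∀ n, (C n).FiniteMeanLength θ) ∧ Tendsto (fun n => (C n).redundancy θ) atTop (𝓝 0)

theorem geometric_hasSum {p : ℝ} (hp0 : 0 < p) (hp1 : p < 1) :
    HasSum (fun i : ℕ+ => ENNReal.ofReal (p * (1 - p) ^ ((i : ℕ) - 1))) 1 := by
  have h : HasSum (fun k : ℕ => ENNReal.ofReal (p * (1 - p) ^ k)) 1 := by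
    have h1 : HasSum (fun k : ℕ => p * (1 - p) ^ k) 1 := by
      have h2 := (hasSum_geometric_of_lt_one (r := 1 - p) (by linarith) (by linarith)).mul_left p
      have h3 : p * (1 - (1 - p))⁻¹ = 1 := by
        rw [sub_sub_cancel, mul_inv_cancel₀ hp0.ne']
      rwa [h3] at h2
    have h4 : ∀ k : ℕ, 0 ≤ p * (1 - p) ^ k := fun k =>
      mul_nonneg hp0.le (pow_nonneg (by linarith) k)
    have h5 := ENNReal.ofReal_tsum_of_nonneg h4 h1.summable
    rw [h1.tsum_eq, ENNReal.ofReal_one] at h5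
    rw [h5]
    exact ENNReal.summable.hasSum
  have h6 := (Equiv.pnatEquivNat.hasSum_iff (f := fun k : ℕ =>
    ENNReal.ofReal (p * (1 - p) ^ k)) (a := 1)).2 h
  exact h6

/-- The geometric distribution `θ_i = p (1 - p)^(i - 1)`, `i = 1, 2, …`, where `0 < p < 1`. -/
noncomputable def geometricDist (p : ℝ) (hp0 : 0 < p) (hp1 : p < 1) : PMF ℕ+ :=
  ⟨fun i => ENNReal.ofReal (p * (1 - p) ^ ((i : ℕ) - 1)), geometric_hasSum hp0 hp1⟩

theorem geometricDist_mem_monotonicDistributions (p : ℝ) (hp0 : 0 < p) (hp1 : p < 1) :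
    geometricDist p hp0 hp1 ∈ monotonicDistributions := by
  intro i j hij
  have h : (i : ℕ) ≤ j := hij
  exact ENNReal.ofReal_le_ofReal (mul_le_mul_of_nonneg_left
    (pow_le_pow_of_le_one (by linarith) (by linarith) (Nat.sub_le_sub_right h 1)) hp0.le)

/-- `m n` (as a function of the block length `n`) is an effective alphabet size of `θ`, in the
range `m = o(n^{1/3})`: the cost `∑_{i > m} n θ_i log i` of the symbols beyond `m` is negligible
with respect to the redundancy `((m - 1) / 2) log (n / m^3)` of an alphabet of size `m`. -/
def IsEffectiveAlphabetSize (θ : PMF ℕ+) (m : ℕ → ℝ) : Prop :=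
  (m =o[atTop] fun n : ℕ => (n : ℝ) ^ (1 / 3 : ℝ)) ∧
  (Summable fun i : ℕ+ => (θ i).toReal * Real.logb 2 (i : ℝ)) ∧
  (fun n : ℕ => ∑' i : {i : ℕ+ // m n < (i : ℝ)},
      (n : ℝ) * (θ i.1).toReal * Real.logb 2 (i.1 : ℝ))
    =o[atTop] fun n : ℕ => (m n - 1) / 2 * Real.logb 2 ((n : ℝ) / m n ^ 3)

/-! Choose a cutoff `m` depending only on `n` and merge all symbols beyond `m` into one letter. A
block is described by its type (the `m + 1` letter counts in Elias delta code), its index in the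
type class, and the merged symbols themselves. All sequences of a type class are equally likely, so
the index costs at most one bit more than the log-inverse-probability of the letter sequence;
merging only raises probabilities, so this is at most `n H + 1` on average. The redundancy is
therefore the cost of counts and merged symbols. A count of mean `w` costs about `log (1 + w)` bits
plus a `log log n` term (`integral_len_typeCode_le`).

Universality: monotonicity gives `k θ_k ≤ 1`, so finite entropy forces `∑ θ_k log k < ∞` and the
merged symbols cost `o(1)` per symbol. With `m` about `log n · log log n`, the counts cost `O((log
n)^3)` bits in all. The lower bound `0` on the redundancy is the Kraft inequality combined with `log
x ≤ x - 1`.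

Geometric case: put `d = -log (1 - p)`. Letter `j` has mean count at most `n (1 - p)^j`, so the
logarithms add up to roughly the positive parts of `log n - j d`, a triangle of area `(log n)^2 / (2
d)` (`sum_max_sub_mul_le`). As `m` exceeds `(log n) / d` eventually, `n (1 - p)^m ≤ 1` and all
remaining costs are `O(log n (log log n)^2)`. -/

/-! ### Self-delimiting binary codes -/

/-- The number of binary digits of `k` (and `1` for `k = 0`). -/
def bitLength (k : ℕ) : ℕ := Nat.log 2 k + 1

theorem lt_two_pow_bitLength (k : ℕ) : k < 2 ^ bitLength k :=
  Nat.lt_pow_succ_log_self one_lt_two k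

theorem bitLength_mono : Monotone bitLength := fun _ _ h =>
  Nat.succ_le_succ (Nat.log_mono_right h)

/-- The `w` low-order binary digits of `k`. -/
def fixedWidthBits (w k : ℕ) : List Bool := List.ofFn fun i : Fin w => k.testBit i

theorem length_fixedWidthBits (w k : ℕ) : (fixedWidthBits w k).length = w := by
  simp [fixedWidthBits]

theorem fixedWidthBits_injOn {w k l : ℕ} (hk : k < 2 ^ w) (hl : l < 2 ^ w)
    (h : fixedWidthBits w k = fixedWidthBits w l) : k = l := by
  have h' := List.ofFn_injective h
  refine Nat.eq_of_testBit_eq fun i => ?_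
  by_cases hi : i < w
  · exact congrFun h' ⟨i, hi⟩
  · have hw : 2 ^ w ≤ 2 ^ i := Nat.pow_le_pow_right two_pos (not_lt.1 hi)
    rw [Nat.testBit_lt_two_pow (hk.trans_le hw), Nat.testBit_lt_two_pow (hl.trans_le hw)]

theorem eq_of_fixedWidthBits_prefix {w k l : ℕ} (hk : k < 2 ^ w) (hl : l < 2 ^ w)
    (h : fixedWidthBits w k <+: fixedWidthBits w l) : k = l :=
  fixedWidthBits_injOn hk hl (h.eq_of_length (by simp only [length_fixedWidthBits]))

/-- The unary code of `w`. -/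
def unaryCode (w : ℕ) : List Bool := List.replicate w true ++ [false]

theorem eq_of_unaryCode_prefix : ∀ {v w : ℕ}, unaryCode v <+: unaryCode w → v = w
  | 0, 0, _ => rfl
  | 0, w + 1, h => by simp [unaryCode, List.replicate_succ] at h
  | v + 1, 0, h => by simp [unaryCode, List.replicate_succ] at h
  | v + 1, w + 1, h => by
    have h' : unaryCode v <+: unaryCode w := by
      simpa [unaryCode, List.replicate_succ] using h
    rw [eq_of_unaryCode_prefix h']

theorem prefix_of_eq {α : Type*} {u v : List α} (h : u = v) : u <+: v := h ▸ List.prefix_rfl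

/-- Cancellation of a self-delimiting first part of a codeword. -/
theorem append_prefix_append {α : Type*} {u₁ u₂ v₁ v₂ : List α}
    (hu : u₁ <+: u₂ ∨ u₂ <+: u₁ → u₁ = u₂) (h : u₁ ++ v₁ <+: u₂ ++ v₂) :
    u₁ = u₂ ∧ v₁ <+: v₂ := by
  have h₁ : u₁ <+: u₂ ++ v₂ := (List.prefix_append u₁ v₁).trans h
  obtain rfl := hu (List.prefix_or_prefix_of_prefix h₁ (List.prefix_append u₂ v₂))
  exact ⟨rfl, (List.prefix_append_right_inj _).1 h⟩

/-- The Elias delta code of the natural numbers. -/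
def eliasDelta (k : ℕ) : List Bool :=
  unaryCode (bitLength (bitLength k)) ++
    (fixedWidthBits (bitLength (bitLength k)) (bitLength k) ++ fixedWidthBits (bitLength k) k)

theorem length_eliasDelta (k : ℕ) :
    (eliasDelta k).length = bitLength k + 2 * bitLength (bitLength k) + 1 := by
  simp [eliasDelta, unaryCode, length_fixedWidthBits]
  omega

/-- Each field announces the width of the next: the unary part that of the length field, the length
field that of the digits. -/
theorem eq_of_eliasDelta_prefix {k l : ℕ} (h : eliasDelta k <+: eliasDelta l) : k = l := by
  obtain ⟨h₁, h₂⟩ := append_prefix_append (fun h => h.elim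
    (fun h => congrArg unaryCode (eq_of_unaryCode_prefix h))
    (fun h => congrArg unaryCode (eq_of_unaryCode_prefix h).symm)) h
  have h₃ := eq_of_unaryCode_prefix (prefix_of_eq h₁)
  rw [h₃] at h₂
  have hk := lt_two_pow_bitLength (bitLength k)
  have hl := lt_two_pow_bitLength (bitLength l)
  rw [h₃] at hk
  obtain ⟨h₄, h₅⟩ := append_prefix_append (fun h => h.elim
    (fun h => congrArg _ (eq_of_fixedWidthBits_prefix hk hl h))
    (fun h => congrArg _ (eq_of_fixedWidthBits_prefix hl hk h).symm)) h₂
  have h₆ := fixedWidthBits_injOn hk hl h₄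
  have hk' := lt_two_pow_bitLength k
  rw [h₆] at h₅ hk'
  exact eq_of_fixedWidthBits_prefix hk' (lt_two_pow_bitLength l) h₅

theorem eliasDelta_eq_of_comparable {k l : ℕ}
    (h : eliasDelta k <+: eliasDelta l ∨ eliasDelta l <+: eliasDelta k) :
    eliasDelta k = eliasDelta l :=
  h.elim (fun h => congrArg _ (eq_of_eliasDelta_prefix h))
    (fun h => congrArg _ (eq_of_eliasDelta_prefix h).symm)

/-- Blocks are parsed from the left. Only comparable blocks at the same index need to agree, so a
block may be empty as long as its partner is; `u` and `v` are what remains to be decoded. -/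
theorem flatten_ofFn_append_prefix {α : Type*} : ∀ {n : ℕ} {f g : Fin n → List α} {u v : List α},
    (∀ i, f i <+: g i ∨ g i <+: f i → f i = g i) →
    (List.ofFn f).flatten ++ u <+: (List.ofFn g).flatten ++ v → f = g ∧ u <+: v
  | 0, f, g, u, v, _, h => ⟨Subsingleton.elim _ _, by simpa using h⟩
  | n + 1, f, g, u, v, hfg, h => by
    rw [List.ofFn_succ, List.ofFn_succ, List.flatten_cons, List.flatten_cons, List.append_assoc,
      List.append_assoc] at h
    obtain ⟨h₀, h₁⟩ := append_prefix_append (hfg 0) h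
    obtain ⟨h₂, h₃⟩ := flatten_ofFn_append_prefix (fun i => hfg i.succ) h₁
    refine ⟨funext fun i => ?_, h₃⟩
    induction i using Fin.cases with
    | zero => exact h₀
    | succ i => exact congrFun h₂ i

/-! ### The type code and its decoding -/

/-- The letter of a symbol: symbols beyond `m` are merged into the letter `m`. -/
def letter (m : ℕ) (k : ℕ+) : Fin (m + 1) := ⟨min k.natPred m, by omega⟩

theorem letter_eq_last_iff {m : ℕ} {k : ℕ+} : letter m k = Fin.last m ↔ m ≤ k.natPred := by
  simp [letter, Fin.ext_iff]

theorem letter_injOn {m : ℕ} {k l : ℕ+} (h : letter m k = letter m l) (hk : k.natPred < m) :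
    k = l := by
  apply PNat.natPred_injective
  simp only [letter, Fin.mk.injEq] at h
  omega

/-- The number of occurrences of each letter in a sequence. -/
def letterCount {n : ℕ} {α : Type*} [DecidableEq α] (z : Fin n → α) (a : α) : ℕ :=
  (Finset.univ.filter fun i => z i = a).card

/-- The sequences with given letter counts. -/
abbrev TypeClass (n : ℕ) {α : Type*} [DecidableEq α] (c : α → ℕ) : Type _ :=
  {z : Fin n → α // letterCount z = c}

/-- The index of a sequence in its type class. -/
noncomputable def typeIndex {n : ℕ} {α : Type*} [Fintype α] [DecidableEq α] (z : Fin n → α) : ℕ :=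
  Fintype.equivFin (TypeClass n (letterCount z)) ⟨z, rfl⟩

theorem typeIndex_lt {n : ℕ} {α : Type*} [Fintype α] [DecidableEq α] (z : Fin n → α) :
    typeIndex z < Fintype.card (TypeClass n (letterCount z)) :=
  (Fintype.equivFin (TypeClass n (letterCount z)) ⟨z, rfl⟩).2

theorem eq_of_typeIndex_eq {n : ℕ} {α : Type*} [Fintype α] [DecidableEq α] {y z : Fin n → α}
    (hc : letterCount y = letterCount z) (h : typeIndex y = typeIndex z) : y = z := by
  -- The two indices live in type classes that are only propositionally equal; a free `c` allows
  -- rewriting along `hc`.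
  have key : ∀ c (hy : letterCount y = c),
      typeIndex y = Fintype.equivFin (TypeClass n c) ⟨y, hy⟩ := by
    rintro _ rfl; rfl
  rw [key _ hc] at h
  exact congrArg Subtype.val ((Fintype.equivFin _).injective (Fin.ext h))

/-- The codeword of the type of a sequence of letters: the letter counts. -/
def countsCode {n m : ℕ} (z : Fin n → Fin (m + 1)) : List Bool :=
  (List.ofFn fun j => eliasDelta (letterCount z j)).flatten

/-- The codeword of a sequence of letters inside its type class. -/
noncomputable def indexCode {n m : ℕ} (z : Fin n → Fin (m + 1)) : List Bool :=
  fixedWidthBits (bitLength (Fintype.card (TypeClass n (letterCount z)))) (typeIndex z)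

/-- The codeword of the symbols beyond `m`, in their order of occurrence. -/
def escapeCode {n : ℕ} (m : ℕ) (x : Fin n → ℕ+) : List Bool :=
  (List.ofFn fun i => if letter m (x i) = Fin.last m then eliasDelta (x i) else []).flatten

/-- The codeword of a sequence of positive integers: the type of its sequence of letters, the
index in the type class, and the symbols beyond `m`. -/
noncomputable def typeEncode (n m : ℕ) (x : Fin n → ℕ+) : List Bool :=
  countsCode (fun i => letter m (x i)) ++ (indexCode (fun i => letter m (x i)) ++ escapeCode m x)

/-- The counts fix the width of the index, counts and index fix the letters, and the letters tell
which positions carry an escaped symbol. -/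
theorem eq_of_typeEncode_prefix {n m : ℕ} {x y : Fin n → ℕ+}
    (h : typeEncode n m x <+: typeEncode n m y) : x = y := by
  obtain ⟨h₁, h₂⟩ := flatten_ofFn_append_prefix (fun _ => eliasDelta_eq_of_comparable) h
  have hc : letterCount (fun i => letter m (x i)) = letterCount (fun i => letter m (y i)) :=
    funext fun j => eq_of_eliasDelta_prefix (prefix_of_eq (congrFun h₁ j))
  have hx := (typeIndex_lt fun i => letter m (x i)).trans (lt_two_pow_bitLength _)
  have hy := (typeIndex_lt fun i => letter m (y i)).trans (lt_two_pow_bitLength _)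
  unfold indexCode at h₂
  rw [hc] at h₂ hx
  obtain ⟨h₃, h₄⟩ := append_prefix_append (fun h => h.elim
    (fun h => congrArg _ (eq_of_fixedWidthBits_prefix hx hy h))
    (fun h => congrArg _ (eq_of_fixedWidthBits_prefix hy hx h).symm)) h₂
  have hz := eq_of_typeIndex_eq hc (fixedWidthBits_injOn hx hy h₃)
  rw [← List.append_nil (escapeCode m x), ← List.append_nil (escapeCode m y)] at h₄
  unfold escapeCode at h₄
  obtain ⟨h₅, -⟩ := flatten_ofFn_append_prefix (fun i hi => by
    have hzi : letter m (x i) = letter m (y i) := congrFun hz i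
    rw [hzi] at hi ⊢
    split_ifs at hi ⊢
    · exact eliasDelta_eq_of_comparable hi
    · rfl) h₄
  funext i
  have hzi : letter m (x i) = letter m (y i) := congrFun hz i
  by_cases hi : letter m (x i) = Fin.last m
  · have h₆ := congrFun h₅ i
    rw [if_pos hi, if_pos (hzi ▸ hi)] at h₆
    exact PNat.eq (eq_of_eliasDelta_prefix (prefix_of_eq h₆))
  · exact letter_injOn hzi (not_le.1 fun h => hi (letter_eq_last_iff.2 h))

/-- The block code that describes a sequence by the type of its sequence of letters, its index in
the type class, and the symbols beyond `m`. -/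
noncomputable def typeCode (n m : ℕ) : BlockCode n :=
  ⟨typeEncode n m, fun _ _ => eq_of_typeEncode_prefix⟩

theorem length_typeEncode (n m : ℕ) (x : Fin n → ℕ+) :
    (typeEncode n m x).length =
      (∑ j, (eliasDelta (letterCount (fun i => letter m (x i)) j)).length) +
      (bitLength (Fintype.card (TypeClass n (letterCount fun i => letter m (x i)))) +
      ∑ i, if letter m (x i) = Fin.last m then (eliasDelta (x i)).length else 0) := by
  simp [typeEncode, countsCode, indexCode, escapeCode, length_fixedWidthBits, List.length_flatten,
    List.map_ofFn, List.sum_ofFn, apply_ite List.length, -List.ofFn_succ]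

/-! ### Pointwise bounds on the codeword length -/

theorem bitLength_le_logb_add_one (k : ℕ) :
    (bitLength k : ℝ) ≤ Real.logb 2 ((k : ℝ) + 1) + 1 := by
  have h : (Nat.log 2 k : ℝ) ≤ Real.logb 2 ((k : ℝ) + 1) := by
    rw [Real.le_logb_iff_rpow_le one_lt_two (by positivity), Real.rpow_natCast]
    rcases Nat.eq_zero_or_pos k with rfl | hk
    · simp
    · have := Nat.pow_log_le_self 2 hk.ne'
      have : (2 : ℝ) ^ Nat.log 2 k ≤ k := by exact_mod_cast this
      linarith
  simpa [bitLength] using h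

theorem bitLength_le_logb {k : ℕ} (hk : 0 < k) : (bitLength k : ℝ) ≤ Real.logb 2 k + 1 := by
  have h : (Nat.log 2 k : ℝ) ≤ Real.logb 2 k := by
    rw [Real.le_logb_iff_rpow_le one_lt_two (by positivity), Real.rpow_natCast]
    exact_mod_cast Nat.pow_log_le_self 2 hk.ne'
  simpa [bitLength] using h

theorem logb_le_bitLength {k : ℕ} (hk : 0 < k) : Real.logb 2 k ≤ bitLength k := by
  rw [Real.logb_le_iff_le_rpow one_lt_two (by positivity), Real.rpow_natCast]
  exact_mod_cast (lt_two_pow_bitLength k).le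

theorem bitLength_bitLength_le (k : ℕ) : bitLength (bitLength k) ≤ bitLength k :=
  Nat.succ_le_of_lt (Nat.log_lt_self 2 (Nat.succ_ne_zero _))

theorem length_eliasDelta_le (k : ℕ+) :
    ((eliasDelta k).length : ℝ) ≤ 3 * Real.logb 2 k + 4 := by
  have h₁ : ((bitLength (bitLength k) : ℕ) : ℝ) ≤ bitLength k := by
    exact_mod_cast bitLength_bitLength_le k
  have h₂ := bitLength_le_logb k.pos
  rw [length_eliasDelta]
  push_cast
  linarith

theorem logb_one_add_le {t : ℝ} (ht : 0 ≤ t) : Real.logb 2 (1 + t) ≤ 2 * t := by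
  have h₁ := Real.log_le_sub_one_of_pos (show 0 < 1 + t by linarith)
  have h₂ : (1 : ℝ) / 2 < Real.log 2 := by linarith [Real.log_two_gt_d9]
  rw [Real.logb, div_le_iff₀ (by linarith)]
  nlinarith

/-- A bound affine in `c`, by concavity of the logarithm. If `w` is the mean of `c`, the middle term
averages to at most `2`, which replaces Jensen's inequality. -/
theorem length_eliasDelta_le_of_le {c n : ℕ} (hc : c ≤ n) {w : ℝ} (hw : 0 ≤ w) :
    ((eliasDelta c).length : ℝ) ≤
      Real.logb 2 (1 + w) + c * (2 / (1 + w)) + (2 + 2 * bitLength (bitLength n)) := by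
  have h₁ : ((bitLength (bitLength c) : ℕ) : ℝ) ≤ bitLength (bitLength n) := by
    exact_mod_cast bitLength_mono (bitLength_mono hc)
  have h₂ := bitLength_le_logb_add_one c
  have hc' : (0 : ℝ) ≤ c / (1 + w) := by positivity
  have h₃ : Real.logb 2 ((c : ℝ) + 1) ≤ Real.logb 2 (1 + w) + c * (2 / (1 + w)) := by
    calc Real.logb 2 ((c : ℝ) + 1) ≤ Real.logb 2 ((1 + w) * (1 + c / (1 + w))) := by
          apply Real.logb_le_logb_of_le one_lt_two (by positivity)
          have : (1 + w) * (1 + c / (1 + w)) = 1 + w + c := by field_simp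
          linarith
      _ = Real.logb 2 (1 + w) + Real.logb 2 (1 + c / (1 + w)) :=
          Real.logb_mul (by positivity) (by positivity)
      _ ≤ Real.logb 2 (1 + w) + c * (2 / (1 + w)) := by
          have := logb_one_add_le hc'
          have h₄ : c * (2 / (1 + w)) = 2 * (c / (1 + w)) := by ring
          linarith
  rw [length_eliasDelta]
  push_cast
  linarith

theorem prod_comp_eq_prod_pow_letterCount {n : ℕ} {α : Type*} [Fintype α] [DecidableEq α] 
    (f : α → ℝ) (z : Fin n → α) :
    ∏ i, f (z i) = ∏ a, f a ^ letterCount z a := by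
  rw [← Finset.prod_fiberwise' Finset.univ z f]
  exact Finset.prod_congr rfl fun a _ => Finset.prod_const _

theorem sum_letterCount_mul {n : ℕ} {α : Type*} [Fintype α] [DecidableEq α] 
    (f : α → ℝ) (z : Fin n → α) :
    ∑ a, (letterCount z a : ℝ) * f a = ∑ i, f (z i) := by
  rw [← Finset.sum_fiberwise' Finset.univ z f]
  refine Finset.sum_congr rfl fun a _ => ?_
  rw [Finset.sum_const, nsmul_eq_mul, letterCount]

theorem letterCount_le {n : ℕ} {α : Type*} [DecidableEq α] (z : Fin n → α) (a : α) :
    letterCount z a ≤ n :=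
  (Finset.card_filter_le _ _).trans_eq (Finset.card_fin n)

theorem PMF.sum_toReal {α : Type*} [Fintype α] (θ : PMF α) : ∑ a, (θ a).toReal = 1 := by
  rw [← ENNReal.toReal_sum fun a _ => θ.apply_ne_top a, ← tsum_fintype (L := .unconditional _),
    θ.tsum_coe, ENNReal.toReal_one]

/-- All sequences of a type class have the same probability, hence this probability is at most the
inverse of the size of the class. -/
theorem card_typeClass_mul_prod_le_one {n : ℕ} {α : Type*} [Fintype α] [DecidableEq α] 
    (θ : PMF α) (z : Fin n → α) :
    (Fintype.card (TypeClass n (letterCount z)) : ℝ) * ∏ i, (θ (z i)).toReal ≤ 1 := by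
  set f : α → ℝ := fun a => (θ a).toReal
  calc (Fintype.card (TypeClass n (letterCount z)) : ℝ) * ∏ i, f (z i)
      = ∑ y : Fin n → α with letterCount y = letterCount z, ∏ i, f (y i) := by
        rw [Fintype.card_subtype, ← nsmul_eq_mul, ← Finset.sum_const]
        refine Finset.sum_congr rfl fun y hy => ?_
        rw [prod_comp_eq_prod_pow_letterCount, prod_comp_eq_prod_pow_letterCount,
          (Finset.mem_filter.1 hy).2]
    _ ≤ ∑ y : Fin n → α, ∏ i, f (y i) :=
        Finset.sum_le_sum_of_subset_of_nonneg (Finset.filter_subset _ _)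
          fun y _ _ => Finset.prod_nonneg fun i _ => ENNReal.toReal_nonneg
    _ = 1 := by rw [← Fintype.sum_pow, PMF.sum_toReal, one_pow]

theorem logb_card_typeClass_le {n : ℕ} {α : Type*} [Fintype α] [DecidableEq α] 
    (θ : PMF α) (z : Fin n → α) (hz : ∀ i, 0 < (θ (z i)).toReal) :
    Real.logb 2 (Fintype.card (TypeClass n (letterCount z))) ≤
      ∑ i, -Real.logb 2 (θ (z i)).toReal := by
  have hcard : 0 < Fintype.card (TypeClass n (letterCount z)) := Fintype.card_pos_iff.2 ⟨⟨z, rfl⟩⟩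
  have hprod : 0 < ∏ i, (θ (z i)).toReal := Finset.prod_pos fun i _ => hz i
  have h := Real.logb_le_logb_of_le one_lt_two
    (mul_pos (Nat.cast_pos.2 hcard) hprod) (card_typeClass_mul_prod_le_one θ z)
  rw [Real.logb_mul (Nat.cast_pos.2 hcard).ne' hprod.ne', Real.logb_prod _ _ fun i _ => (hz i).ne',
    Real.logb_one] at h
  rw [Finset.sum_neg_distrib]
  linarith

theorem PMF.apply_le_map_apply {α β : Type*} (θ : PMF α) (f : α → β) (a : α) :
    (θ a).toReal ≤ ((θ.map f) (f a)).toReal := by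
  classical
  refine ENNReal.toReal_mono (PMF.apply_ne_top _ _) ?_
  rw [PMF.map_apply]
  exact le_of_eq_of_le (by simp) (ENNReal.le_tsum a)

/-- The cost, in bits, of writing down a symbol if it is beyond `m`. -/
noncomputable def escapeCost (m : ℕ) (k : ℕ+) : ℝ :=
  if m ≤ k.natPred then 3 * Real.logb 2 k + 4 else 0

theorem BlockCode.len_nonneg {n : ℕ} (C : BlockCode n) (x : Fin n → ℕ+) : 0 ≤ C.len x :=
  Nat.cast_nonneg _

/-- The bound is a constant plus a sum of functions of single symbols, so its expectation reduces to
one-symbol integrals. Null symbols are excluded because `Real.logb 2 0 = 0` would give them no cost.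
-/
theorem len_typeCode_le {n m : ℕ} (θ : PMF ℕ+) {w : Fin (m + 1) → ℝ} (hw : ∀ j, 0 ≤ w j)
    {x : Fin n → ℕ+} (hx : ∀ i, θ (x i) ≠ 0) :
    (typeCode n m).len x ≤
      (∑ j, Real.logb 2 (1 + w j) + (m + 1) * (2 + 2 * bitLength (bitLength n)) + 1) +
      ∑ i, (-Real.logb 2 (θ (x i)).toReal + 2 / (1 + w (letter m (x i))) +
        escapeCost m (x i)) := by
  set z : Fin n → Fin (m + 1) := fun i => letter m (x i)
  have hpos : ∀ i, 0 < (θ (x i)).toReal := fun i =>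
    ENNReal.toReal_pos (hx i) (θ.apply_ne_top _)
  have hmap : ∀ i, (θ (x i)).toReal ≤ ((θ.map (letter m)) (z i)).toReal := fun i =>
    θ.apply_le_map_apply (letter m) (x i)
  have h₁ : ((∑ j, (eliasDelta (letterCount z j)).length : ℕ) : ℝ) ≤
      ∑ j, Real.logb 2 (1 + w j) + ∑ i, 2 / (1 + w (z i)) +
        (m + 1) * (2 + 2 * bitLength (bitLength n)) := by
    push_cast
    refine (Finset.sum_le_sum fun j _ => length_eliasDelta_le_of_le (letterCount_le z j)
      (hw j)).trans_eq ?_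
    rw [Finset.sum_add_distrib, Finset.sum_add_distrib,
      sum_letterCount_mul (fun j => 2 / (1 + w j))]
    simp [mul_add]
  have h₂ : ((bitLength (Fintype.card (TypeClass n (letterCount z))) : ℕ) : ℝ) ≤
      ∑ i, -Real.logb 2 (θ (x i)).toReal + 1 := by
    have hcard : 0 < Fintype.card (TypeClass n (letterCount z)) :=
      Fintype.card_pos_iff.2 ⟨⟨z, rfl⟩⟩
    have := logb_card_typeClass_le (θ.map (letter m)) z fun i => (hpos i).trans_le (hmap i)
    have : ∑ i, -Real.logb 2 ((θ.map (letter m)) (z i)).toReal ≤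
        ∑ i, -Real.logb 2 (θ (x i)).toReal :=
      Finset.sum_le_sum fun i _ => neg_le_neg
        (Real.logb_le_logb_of_le one_lt_two (hpos i) (hmap i))
    linarith [bitLength_le_logb hcard]
  have h₃ : ((∑ i, if letter m (x i) = Fin.last m then (eliasDelta (x i)).length else 0 : ℕ) : ℝ) ≤
      ∑ i, escapeCost m (x i) := by
    push_cast
    refine Finset.sum_le_sum fun i _ => ?_
    unfold escapeCost
    simp only [letter_eq_last_iff]
    split_ifs
    · exact length_eliasDelta_le _
    · simp
  have h₄ : (typeCode n m).len x = ((typeEncode n m x).length : ℝ) := rfl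
  rw [h₄, length_typeEncode, Finset.sum_add_distrib, Finset.sum_add_distrib]
  rw [Nat.cast_add, Nat.cast_add]
  linarith

/-! ### Expected codeword length -/

theorem integrable_iff_summable_of_countable {α : Type*} [MeasurableSpace α] [Countable α]
    [MeasurableSingletonClass α] (μ : Measure α) [IsFiniteMeasure μ] (f : α → ℝ) :
    Integrable f μ ↔ Summable fun a => μ.real {a} * f a := by
  conv_lhs => rw [← Measure.sum_smul_dirac μ]
  rw [integrable_sum_dirac_iff fun a => measure_ne_top μ _,
    ← summable_abs_iff (f := fun a => μ.real {a} * f a)]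
  simp only [abs_mul, Real.norm_eq_abs, measureReal_def,
    abs_of_nonneg ENNReal.toReal_nonneg]

theorem PMF.integrable_iff_summable {α : Type*} [MeasurableSpace α] [Countable α]
    [MeasurableSingletonClass α] (θ : PMF α) (f : α → ℝ) :
    Integrable f θ.toMeasure ↔ Summable fun a => (θ a).toReal * f a := by
  simp only [integrable_iff_summable_of_countable, measureReal_def,
    PMF.toMeasure_apply_singleton _ _ (measurableSet_singleton _)]

theorem integral_iidLaw_sum (θ : PMF ℕ+) (n : ℕ) {f : ℕ+ → ℝ} (hf : Integrable f θ.toMeasure) :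
    Integrable (fun x => ∑ i, f (x i)) (iidLaw θ n) ∧
      ∫ x, ∑ i, f (x i) ∂iidLaw θ n = n * ∫ k, f k ∂θ.toMeasure := by
  have h : ∀ i : Fin n, Integrable (fun x : Fin n → ℕ+ => f (x i)) (iidLaw θ n) := fun i =>
    integrable_comp_eval hf
  refine ⟨integrable_finsetSum _ fun i _ => h i, ?_⟩
  rw [integral_finsetSum _ fun i _ => h i]
  have : ∀ i : Fin n, ∫ x, f (x i) ∂iidLaw θ n = ∫ k, f k ∂θ.toMeasure := fun i =>
    integral_comp_eval hf.aestronglyMeasurable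
  simp [this]

instance (θ : PMF ℕ+) (n : ℕ) : IsProbabilityMeasure (iidLaw θ n) := by
  unfold iidLaw; infer_instance

theorem ae_iidLaw_apply_ne_zero (θ : PMF ℕ+) (n : ℕ) :
    ∀ᵐ x ∂iidLaw θ n, ∀ i, θ (x i) ≠ 0 := by
  refine ae_all_iff.2 fun i => ?_
  have h : ∀ᵐ k ∂θ.toMeasure, θ k ≠ 0 := by
    rw [ae_iff, PMF.toMeasure_apply_eq_zero_iff _ (MeasurableSet.of_discrete)]
    exact Set.disjoint_left.2 fun k hk hk' => hk' hk
  exact (measurePreserving_eval (fun _ : Fin n => θ.toMeasure) i).quasiMeasurePreserving.ae h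

theorem toReal_mul_neg_logb (t : ℝ) : t * -Real.logb 2 t = Real.negMulLog t / Real.log 2 := by
  rw [Real.negMulLog, Real.logb]; ring

theorem FiniteEntropy.integrable_neg_logb {θ : PMF ℕ+} (h : FiniteEntropy θ) :
    Integrable (fun k => -Real.logb 2 (θ k).toReal) θ.toMeasure ∧
      ∫ k, -Real.logb 2 (θ k).toReal ∂θ.toMeasure = entropyBits θ := by
  have hi : Integrable (fun k => -Real.logb 2 (θ k).toReal) θ.toMeasure := by
    rw [PMF.integrable_iff_summable]
    simp only [toReal_mul_neg_logb]
    exact h.div_const _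
  refine ⟨hi, ?_⟩
  rw [PMF.integral_eq_tsum _ _ hi]
  simp only [smul_eq_mul, toReal_mul_neg_logb]
  exact tsum_div_const

theorem integrable_escapeCost {θ : PMF ℕ+}
    (hlog : Summable fun k : ℕ+ => (θ k).toReal * Real.logb 2 (k : ℝ)) (m : ℕ) :
    Integrable (escapeCost m) θ.toMeasure := by
  have h : Integrable (fun k : ℕ+ => 3 * Real.logb 2 (k : ℝ) + 4) θ.toMeasure :=
    (((PMF.integrable_iff_summable _ _).2 hlog).const_mul 3).add (integrable_const 4)
  refine h.mono (measurable_of_countable _).aestronglyMeasurable (ae_of_all _ fun k => ?_)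
  unfold escapeCost
  split_ifs <;> simp

theorem PMF.toReal_apply_le_one {α : Type*} (θ : PMF α) (a : α) : (θ a).toReal ≤ 1 :=
  ENNReal.toReal_mono ENNReal.one_ne_top (θ.coe_le_one a)

/-- The expected length of the code: the entropy of the block, the counts of the letters, and the
symbols beyond `m`. -/
theorem integral_len_typeCode_le {θ : PMF ℕ+} (hθ : FiniteEntropy θ)
    (hlog : Summable fun k : ℕ+ => (θ k).toReal * Real.logb 2 (k : ℝ)) (n m : ℕ) :
    (typeCode n m).FiniteMeanLength θ ∧
    ∫ x, (typeCode n m).len x ∂iidLaw θ n ≤ n * entropyBits θ +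
      (∑ j, Real.logb 2 (1 + n * ((θ.map (letter m)) j).toReal) +
        (m + 1) * (4 + 2 * bitLength (bitLength n)) + 1) +
      n * ∫ k, escapeCost m k ∂θ.toMeasure := by
  set w : Fin (m + 1) → ℝ := fun j => n * ((θ.map (letter m)) j).toReal
  have hw : ∀ j, 0 ≤ w j := fun j => by positivity
  obtain ⟨hi₁, hv₁⟩ := hθ.integrable_neg_logb
  have hmeas : Measurable (letter m) := measurable_of_countable _
  have hi₂' : Integrable (fun j => 2 / (1 + w j)) (θ.map (letter m)).toMeasure := .of_finite
  have hi₂ : Integrable (fun k => 2 / (1 + w (letter m k))) θ.toMeasure := by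
    rw [← PMF.toMeasure_map _ _ hmeas] at hi₂'
    exact hi₂'.comp_measurable hmeas
  -- Each letter contributes `2 w j / (1 + w j) ≤ 2`.
  have hv₂ : n * ∫ k, 2 / (1 + w (letter m k)) ∂θ.toMeasure ≤ (m + 1) * 2 := by
    rw [← integral_map (f := fun j => 2 / (1 + w j)) hmeas.aemeasurable
      (measurable_of_countable _).aestronglyMeasurable, PMF.toMeasure_map _ _ hmeas,
      PMF.integral_eq_sum, Finset.mul_sum]
    calc _ ≤ ∑ j : Fin (m + 1), (2 : ℝ) := Finset.sum_le_sum fun j _ => ?_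
      _ = _ := by simp
    rw [smul_eq_mul, ← mul_assoc, mul_div_assoc', div_le_iff₀ (by linarith [hw j])]
    have : w j = n * ((θ.map (letter m)) j).toReal := rfl
    linarith
  have hi₃ := integrable_escapeCost hlog m
  have hi₁₂ := hi₁.add hi₂
  obtain ⟨hi, hv⟩ := integral_iidLaw_sum θ n (hi₁₂.add hi₃)
  have hle : ∀ᵐ x ∂iidLaw θ n, (typeCode n m).len x ≤ _ :=
    (ae_iidLaw_apply_ne_zero θ n).mono fun x hx => len_typeCode_le (m := m) θ hw hx
  have hbound := (integrable_const (μ := iidLaw θ n)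
    (∑ j, Real.logb 2 (1 + w j) + (m + 1) * (2 + 2 * bitLength (bitLength n)) + 1)).add hi
  have hlen : Integrable (typeCode n m).len (iidLaw θ n) := by
    refine hbound.mono' (measurable_of_countable _).aestronglyMeasurable (hle.mono fun x hx => ?_)
    rw [Real.norm_of_nonneg ((typeCode n m).len_nonneg x)]
    exact hx
  refine ⟨hlen, (integral_mono_ae hlen hbound hle).trans ?_⟩
  rw [integral_add' (integrable_const _) hi, hv, integral_add' hi₁₂ hi₃, integral_add' hi₁ hi₂, hv₁,
    integral_const]
  simp only [probReal_univ, one_smul, mul_add]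
  linarith

/-! ### The entropy lower bound -/

theorem uniquelyDecodable_of_prefixFree {α : Type*} {S : Set (List α)} (hnil : [] ∉ S)
    (hS : ∀ u ∈ S, ∀ v ∈ S, u <+: v → u = v) : InformationTheory.UniquelyDecodable S := by
  intro L₁
  induction L₁ with
  | nil =>
    intro L₂ _ h₂ h
    cases L₂ with
    | nil => rfl
    | cons v L₂ =>
      have hv : v = [] := by
        rw [List.flatten_nil, List.flatten_cons, eq_comm, List.append_eq_nil_iff] at h
        exact h.1
      exact absurd (h₂ v (by simp)) (hv ▸ hnil)
  | cons u L₁ ih =>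
    intro L₂ h₁ h₂ h
    cases L₂ with
    | nil =>
      have hu : u = [] := by
        rw [List.flatten_nil, List.flatten_cons, List.append_eq_nil_iff] at h
        exact h.1
      exact absurd (h₁ u (by simp)) (hu ▸ hnil)
    | cons v L₂ =>
      have hu := h₁ u (by simp)
      have hv := h₂ v (by simp)
      rw [List.flatten_cons, List.flatten_cons] at h
      obtain ⟨rfl, -⟩ := append_prefix_append
        (fun h => h.elim (hS u hu v hv) (fun h => (hS v hv u hu h).symm)) (prefix_of_eq h)
      rw [ih L₂ (fun w hw => h₁ w (by simp [hw])) (fun w hw => h₂ w (by simp [hw]))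
        (List.append_cancel_left h)]

theorem BlockCode.sum_two_pow_neg_length_le_one {n : ℕ} (hn : 0 < n) (C : BlockCode n)
    (s : Finset (Fin n → ℕ+)) : ∑ x ∈ s, (1 / 2 : ℝ) ^ (C.encode x).length ≤ 1 := by
  classical
  have hinj : Function.Injective C.encode := fun x y h => C.prefixFree x y (prefix_of_eq h)
  -- An empty codeword would be a prefix of the codewords of two different constant sequences; for
  -- `n = 0` it is possible.
  have hne : ∀ x, C.encode x ≠ [] := fun x hx => by
    have h₁ := C.prefixFree x (fun _ => 1) (hx ▸ List.nil_prefix)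
    have h₂ := C.prefixFree x (fun _ => 2) (hx ▸ List.nil_prefix)
    have h₃ := congrFun (h₁.symm.trans h₂) ⟨0, hn⟩
    exact absurd h₃ (by decide)
  have hud : InformationTheory.UniquelyDecodable
      ((s.image C.encode : Finset (List Bool)) : Set (List Bool)) := by
    apply uniquelyDecodable_of_prefixFree
    · simp [hne]
    · intro u hu v hv huv
      obtain ⟨x, -, rfl⟩ := Finset.mem_image.1 hu
      obtain ⟨y, -, rfl⟩ := Finset.mem_image.1 hv
      exact congrArg _ (C.prefixFree x y huv)
  have h := InformationTheory.kraft_mcmillan_inequality hud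
  rw [Finset.sum_image hinj.injOn] at h
  simpa using h

theorem iidLaw_real_singleton (θ : PMF ℕ+) {n : ℕ} (x : Fin n → ℕ+) :
    (iidLaw θ n).real {x} = ∏ i, (θ (x i)).toReal := by
  rw [measureReal_def, iidLaw, Measure.pi_singleton, ENNReal.toReal_prod]
  simp only [PMF.toMeasure_apply_singleton _ _ (measurableSet_singleton _)]

/-- The expected length of a prefix code is at least the entropy of the block. -/
theorem BlockCode.mul_entropyBits_le_integral_len {n : ℕ} (hn : 0 < n) (C : BlockCode n)
    {θ : PMF ℕ+} (hθ : FiniteEntropy θ) (hC : C.FiniteMeanLength θ) :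
    n * entropyBits θ ≤ ∫ x, C.len x ∂iidLaw θ n := by
  set P : (Fin n → ℕ+) → ℝ := fun x => ∏ i, (θ (x i)).toReal
  -- Ratio of Kraft weight to probability. Its mean is at most `1`, so `log g ≤ g - 1` integrates to
  -- Gibbs' inequality.
  set g : (Fin n → ℕ+) → ℝ := fun x => (1 / 2 : ℝ) ^ (C.encode x).length / P x
  have hP : ∀ x, 0 ≤ P x := fun x => Finset.prod_nonneg fun i _ => ENNReal.toReal_nonneg
  have hterm : ∀ x, 0 ≤ (iidLaw θ n).real {x} * g x := fun x =>
    mul_nonneg measureReal_nonneg (div_nonneg (by positivity) (hP x))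
  have hterm' : ∀ x, (iidLaw θ n).real {x} * g x ≤ (1 / 2 : ℝ) ^ (C.encode x).length := fun x => by
    rw [iidLaw_real_singleton]
    rcases (hP x).eq_or_lt with h | h
    · have h' : ∏ i, (θ (x i)).toReal = 0 := h.symm
      rw [h', zero_mul]
      positivity
    · exact (mul_div_cancel₀ _ h.ne').le
  have hfin : ∀ s : Finset (Fin n → ℕ+), ∑ x ∈ s, (iidLaw θ n).real {x} * g x ≤ 1 := fun s =>
    (Finset.sum_le_sum fun x _ => hterm' x).trans (C.sum_two_pow_neg_length_le_one hn s)
  have hgi : Integrable g (iidLaw θ n) := by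
    rw [integrable_iff_summable_of_countable]
    exact summable_of_sum_le hterm hfin
  have hg1 : ∫ x, g x ∂iidLaw θ n ≤ 1 := by
    rw [integral_countable hgi]
    exact Real.tsum_le_of_sum_le hterm hfin
  obtain ⟨hi₁, hv₁⟩ := hθ.integrable_neg_logb
  obtain ⟨hi, hv⟩ := integral_iidLaw_sum θ n hi₁
  rw [hv₁] at hv
  have hlog2 : 0 < Real.log 2 := Real.log_pos one_lt_two
  have hpt : ∀ᵐ x ∂iidLaw θ n,
      (1 - g x) / Real.log 2 ≤ C.len x - ∑ i, -Real.logb 2 (θ (x i)).toReal := by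
    filter_upwards [ae_iidLaw_apply_ne_zero θ n] with x hx
    have hpos : ∀ i, (θ (x i)).toReal ≠ 0 := fun i =>
      (ENNReal.toReal_pos (hx i) (θ.apply_ne_top _)).ne'
    have hPx : 0 < P x := Finset.prod_pos fun i _ => (hpos i).symm.lt_of_le ENNReal.toReal_nonneg
    have h := Real.log_le_sub_one_of_pos (show 0 < g x by positivity)
    have h' : Real.log (g x) = -(C.len x * Real.log 2) - Real.log (P x) := by
      rw [Real.log_div (by positivity) hPx.ne', Real.log_pow, one_div, Real.log_inv,
        BlockCode.len]
      ring
    have h'' : ∑ i, -Real.logb 2 (θ (x i)).toReal = -(Real.log (P x) / Real.log 2) := by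
      rw [Finset.sum_neg_distrib, ← Real.logb_prod _ _ fun i _ => hpos i, Real.logb]
    rw [h'', div_le_iff₀ hlog2, sub_neg_eq_add, add_mul, div_mul_cancel₀ _ hlog2.ne']
    linarith
  have h := integral_mono_ae (((integrable_const 1).sub hgi).div_const _) (hC.sub hi) hpt
  rw [integral_sub' hC hi, hv] at h
  have h0 : 0 ≤ ∫ x, (1 - g x) / Real.log 2 ∂iidLaw θ n := by
    rw [integral_div, integral_sub (integrable_const 1) hgi]
    refine div_nonneg ?_ hlog2.le
    simpa using hg1
  have h1 := h0.trans h
  linarith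

theorem BlockCode.redundancy_nonneg {n : ℕ} (hn : 0 < n) (C : BlockCode n)
    {θ : PMF ℕ+} (hθ : FiniteEntropy θ) (hC : C.FiniteMeanLength θ) : 0 ≤ C.redundancy θ := by
  have h := C.mul_entropyBits_le_integral_len hn hθ hC
  have hn' : (0 : ℝ) < n := Nat.cast_pos.2 hn
  rw [BlockCode.redundancy, one_div, inv_mul_eq_div, sub_nonneg, le_div_iff₀ hn']
  linarith

/-! ### Universality for monotonic distributions -/

theorem mul_toReal_le_one {θ : PMF ℕ+} (hθ : θ ∈ monotonicDistributions) (k : ℕ+) :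
    (k : ℝ) * (θ k).toReal ≤ 1 := by
  have h : ((k : ℕ) : ENNReal) * θ k ≤ 1 := by
    calc ((k : ℕ) : ENNReal) * θ k = ∑ i ∈ Finset.Icc 1 k, θ k := by
          rw [Finset.sum_const, PNat.card_Icc, nsmul_eq_mul]; simp
      _ ≤ ∑ i ∈ Finset.Icc 1 k, θ i :=
          Finset.sum_le_sum fun i hi => hθ (Finset.mem_Icc.1 hi).2
      _ ≤ ∑' i, θ i := ENNReal.sum_le_tsum _
      _ = 1 := θ.tsum_coe
  simpa using ENNReal.toReal_mono ENNReal.one_ne_top h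

/-- Since `k θ_k ≤ 1`, `log k ≤ -log θ_k` on the support. Universality uses monotonicity only here.
-/
theorem FiniteEntropy.summable_mul_logb {θ : PMF ℕ+} (hθ : θ ∈ monotonicDistributions)
    (h : FiniteEntropy θ) : Summable fun k : ℕ+ => (θ k).toReal * Real.logb 2 (k : ℝ) := by
  refine Summable.of_nonneg_of_le (fun k => ?_) (fun k => ?_) (h.div_const (Real.log 2))
  · exact mul_nonneg ENNReal.toReal_nonneg
      (Real.logb_nonneg one_lt_two (by exact_mod_cast one_le (a := k)))
  · rw [← toReal_mul_neg_logb]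
    rcases (ENNReal.toReal_nonneg (a := θ k)).eq_or_lt with h0 | h0
    · simp [← h0]
    · have hk : (0 : ℝ) < k := by exact_mod_cast k.pos
      refine mul_le_mul_of_nonneg_left ?_ h0.le
      have h1 := Real.logb_le_logb_of_le one_lt_two (mul_pos hk h0) (mul_toReal_le_one hθ k)
      rw [Real.logb_mul hk.ne' h0.ne', Real.logb_one] at h1
      linarith

theorem tendsto_bitLength_atTop : Tendsto bitLength atTop atTop :=
  tendsto_atTop_atTop_of_monotone bitLength_mono fun b =>
    ⟨2 ^ b, by rw [bitLength, Nat.log_pow one_lt_two]; omega⟩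

/-- Used at `n` for universality and at `bitLength n` for the geometric remainder. -/
theorem tendsto_bitLength_pow_div :
    Tendsto (fun n : ℕ => (bitLength n : ℝ) ^ 3 / n) atTop (𝓝 0) := by
  have h : Tendsto (fun n : ℕ => 27 * (Real.log n ^ 3 / n)) atTop (𝓝 0) := by
    have := (Real.isLittleO_pow_log_id_atTop (n := 3)).tendsto_div_nhds_zero.comp
      tendsto_natCast_atTop_atTop
    simpa using this.const_mul 27
  refine squeeze_zero' (Eventually.of_forall fun n => by positivity) ?_ h
  filter_upwards [eventually_ge_atTop 3] with n hn
  have hn' : (3 : ℝ) ≤ n := by exact_mod_cast hn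
  have h1 : 1 ≤ Real.log n := by
    rw [Real.le_log_iff_exp_le (by linarith)]
    linarith [Real.exp_one_lt_d9]
  have h2 := bitLength_le_logb (show 0 < n by omega)
  have h3 : Real.logb 2 n ≤ 2 * Real.log n := by
    rw [Real.logb, div_le_iff₀ (Real.log_pos one_lt_two)]
    nlinarith [Real.log_two_gt_d9]
  have h4 : (bitLength n : ℝ) ≤ 3 * Real.log n := by linarith
  calc (bitLength n : ℝ) ^ 3 / n ≤ (3 * Real.log n) ^ 3 / n := by gcongr
    _ = 27 * (Real.log n ^ 3 / n) := by ring

theorem one_le_bitLength (k : ℕ) : 1 ≤ bitLength k := Nat.succ_le_succ (Nat.zero_le _)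

/-- The cutoff, larger than `log n` and smaller than `(log n)^2` in order of magnitude. -/
def cutoff (n : ℕ) : ℕ := bitLength n * bitLength (bitLength n)

theorem bitLength_le_cutoff (n : ℕ) : bitLength n ≤ cutoff n :=
  Nat.le_mul_of_pos_right _ (one_le_bitLength _)

theorem tendsto_cutoff_atTop : Tendsto cutoff atTop atTop :=
  tendsto_atTop_mono bitLength_le_cutoff tendsto_bitLength_atTop

/-- The universal code for blocks of length `n`. -/
noncomputable def monotonicCode (n : ℕ) : BlockCode n := typeCode n (cutoff n)

theorem redundancy_typeCode_le {θ : PMF ℕ+} (hθ : FiniteEntropy θ)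
    (hlog : Summable fun k : ℕ+ => (θ k).toReal * Real.logb 2 (k : ℝ)) {n : ℕ} (hn : 0 < n)
    (m : ℕ) :
    (typeCode n m).redundancy θ ≤ (∑ j, Real.logb 2 (1 + n * ((θ.map (letter m)) j).toReal) +
        (m + 1) * (4 + 2 * bitLength (bitLength n)) + 1) / n +
      ∫ k, escapeCost m k ∂θ.toMeasure := by
  have hn' : (0 : ℝ) < n := Nat.cast_pos.2 hn
  have h := (integral_len_typeCode_le hθ hlog n m).2
  rw [BlockCode.redundancy, one_div, inv_mul_eq_div, sub_le_iff_le_add, div_le_iff₀ hn', add_mul,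
    add_mul, div_mul_cancel₀ _ hn'.ne']
  linarith

/-- Dominated convergence: `escapeCost 0` dominates, and each fixed symbol eventually falls below
the cutoff. -/
theorem tendsto_integral_escapeCost {θ : PMF ℕ+}
    (hlog : Summable fun k : ℕ+ => (θ k).toReal * Real.logb 2 (k : ℝ)) :
    Tendsto (fun m => ∫ k, escapeCost m k ∂θ.toMeasure) atTop (𝓝 0) := by
  have h := tendsto_integral_of_dominated_convergence (μ := θ.toMeasure) (F := escapeCost)
    (f := fun _ => 0) (escapeCost 0) (fun m => (measurable_of_countable _).aestronglyMeasurable)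
    (integrable_escapeCost hlog 0) (fun m => ae_of_all _ fun k => ?_) (ae_of_all _ fun k => ?_)
  · simpa using h
  · have hk : 0 ≤ Real.logb 2 (k : ℝ) :=
      Real.logb_nonneg one_lt_two (by exact_mod_cast one_le (a := k))
    have h4 : 0 ≤ 3 * Real.logb 2 (k : ℝ) + 4 := by linarith
    simp only [escapeCost, Nat.zero_le, if_true]
    split_ifs
    · rw [Real.norm_of_nonneg h4]
    · simpa using h4
  · refine tendsto_const_nhds.congr' ?_
    filter_upwards [eventually_gt_atTop k.natPred] with m hm
    rw [escapeCost, if_neg (not_le.2 hm)]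

theorem logb_one_add_mul_le {n : ℕ} (hn : 0 < n) {t : ℝ} (ht0 : 0 ≤ t) (ht : t ≤ 1) :
    Real.logb 2 (1 + n * t) ≤ Real.logb 2 n + 1 := by
  have hn' : (1 : ℝ) ≤ n := by exact_mod_cast hn
  have h : Real.logb 2 (n * 2) = Real.logb 2 n + 1 := by
    rw [Real.logb_mul (by positivity) two_ne_zero, Real.logb_self_eq_one one_lt_two]
  rw [← h]
  apply Real.logb_le_logb_of_le one_lt_two (by positivity)
  nlinarith

theorem redundancy_monotonicCode_le {θ : PMF ℕ+} (hθ : FiniteEntropy θ)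
    (hlog : Summable fun k : ℕ+ => (θ k).toReal * Real.logb 2 (k : ℝ)) {n : ℕ} (hn : 0 < n) :
    (monotonicCode n).redundancy θ ≤
      17 * ((bitLength n : ℝ) ^ 3 / n) + ∫ k, escapeCost (cutoff n) k ∂θ.toMeasure := by
  refine (redundancy_typeCode_le hθ hlog hn _).trans (add_le_add_left ?_ _)
  rw [mul_div_assoc']
  refine div_le_div_of_nonneg_right ?_ (Nat.cast_nonneg n)
  have h₁ : ∑ j, Real.logb 2 (1 + n * ((θ.map (letter (cutoff n))) j).toReal) ≤
      (cutoff n + 1) * (bitLength n + 1) := by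
    calc _ ≤ ∑ j : Fin (cutoff n + 1), ((bitLength n : ℝ) + 1) := Finset.sum_le_sum fun j _ =>
          (logb_one_add_mul_le hn ENNReal.toReal_nonneg (PMF.toReal_apply_le_one _ _)).trans
            (by linarith [logb_le_bitLength hn])
      _ = _ := by simp [mul_add]
  have hb : (1 : ℝ) ≤ bitLength n := by exact_mod_cast one_le_bitLength n
  have hbb : ((bitLength (bitLength n) : ℕ) : ℝ) ≤ bitLength n := by
    exact_mod_cast bitLength_bitLength_le n
  have hm : (cutoff n : ℝ) ≤ (bitLength n : ℝ) ^ 2 := by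
    rw [cutoff, Nat.cast_mul, sq]
    gcongr
  generalize (bitLength n : ℝ) = b at *
  have hm0 : (0 : ℝ) ≤ cutoff n := Nat.cast_nonneg _
  have h₂ : ((cutoff n : ℝ) + 1) * (4 + 2 * (bitLength (bitLength n) : ℕ)) ≤
      (cutoff n + 1) * (4 + 2 * b) := by gcongr
  -- This gives `16 b ^ 3`; the leftover `1 ≤ b ^ 3` makes the constant `17`.
  have h₃ : ((cutoff n : ℝ) + 1) * (b + 1 + (4 + 2 * b)) ≤ (2 * b ^ 2) * (8 * b) := by
    apply mul_le_mul _ _ (by positivity) (by positivity) <;> nlinarith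
  have h₄ : 1 ≤ b ^ 3 := one_le_pow₀ hb
  linarith

theorem isUniversalMonotonic_monotonicCode : IsUniversalMonotonic monotonicCode := by
  intro θ hmono hθ
  have hlog := hθ.summable_mul_logb hmono
  have hfin : ∀ n, (monotonicCode n).FiniteMeanLength θ := fun n =>
    (integral_len_typeCode_le hθ hlog n _).1
  refine ⟨hfin, ?_⟩
  have hlim := (tendsto_bitLength_pow_div.const_mul 17).add
    ((tendsto_integral_escapeCost hlog).comp tendsto_cutoff_atTop)
  rw [mul_zero, add_zero] at hlim
  refine squeeze_zero' ?_ ?_ hlim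
  · filter_upwards [eventually_gt_atTop 0] with n hn
    exact (monotonicCode n).redundancy_nonneg hn hθ (hfin n)
  · filter_upwards [eventually_gt_atTop 0] with n hn
    exact redundancy_monotonicCode_le hθ hlog hn

/-! ### Redundancy on geometric distributions -/

theorem summable_comp_natPred {f : ℕ → ℝ} (hf : Summable f) :
    Summable fun k : ℕ+ => f k.natPred :=
  hf.comp_injective PNat.natPred_injective

theorem tsum_comp_natPred (f : ℕ → ℝ) : ∑' k : ℕ+, f k.natPred = ∑' j, f j :=
  Equiv.pnatEquivNat.tsum_eq f

theorem natPred_cast_add_one (k : ℕ+) : (k.natPred : ℝ) + 1 = k := by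
  exact_mod_cast k.natPred_add_one

theorem summable_pow_mul_succ {q : ℝ} (hq0 : 0 < q) (hq1 : q < 1) :
    Summable fun j : ℕ => q ^ j * ((j : ℝ) + 1) := by
  have h₁ := summable_pow_mul_geometric_of_norm_lt_one (r := q) 1
    (by rwa [Real.norm_of_nonneg hq0.le])
  have h₂ := summable_geometric_of_lt_one hq0.le hq1
  refine (h₁.add h₂).congr fun j => ?_
  ring

/-- The tail of the series `∑ q^j (j + 1)`. -/
theorem tsum_tail_pow_mul_succ_le {q : ℝ} (hq0 : 0 < q) (hq1 : q < 1) (M : ℕ) :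
    (Summable fun k : ℕ+ => if M ≤ k.natPred then q ^ k.natPred * (k : ℝ) else 0) ∧
    ∑' k : ℕ+, (if M ≤ k.natPred then q ^ k.natPred * (k : ℝ) else 0) ≤
      q ^ M * (M + 1) * ∑' j : ℕ, q ^ j * ((j : ℝ) + 1) := by
  set f : ℕ → ℝ := fun j => if M ≤ j then q ^ j * ((j : ℝ) + 1) else 0
  have hsum := summable_pow_mul_succ hq0 hq1
  have hf : Summable f := by
    refine Summable.of_nonneg_of_le (fun j => ?_) (fun j => ?_) hsum
    · simp only [f]; split_ifs <;> positivity
    · simp only [f]; split_ifs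
      · exact le_rfl
      · positivity
  have hfk : (fun k : ℕ+ => if M ≤ k.natPred then q ^ k.natPred * (k : ℝ) else 0) =
      fun k => f k.natPred := by
    funext k
    simp only [f, natPred_cast_add_one]
  rw [hfk, tsum_comp_natPred, ← hf.sum_add_tsum_nat_add M, Finset.sum_eq_zero, zero_add,
    ← tsum_mul_left]
  · refine ⟨summable_comp_natPred hf, ?_⟩
    refine ((summable_nat_add_iff M).2 hf).tsum_le_tsum (fun i => ?_) (hsum.mul_left _)
    simp only [f, if_pos (Nat.le_add_left M i), pow_add, Nat.cast_add]
    have h : (i : ℝ) + M + 1 ≤ (M + 1) * (i + 1) := by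
      have : (0 : ℝ) ≤ M * i := by positivity
      linarith
    calc q ^ i * q ^ M * ((i : ℝ) + M + 1) ≤ q ^ i * q ^ M * ((M + 1) * (i + 1)) := by gcongr
      _ = _ := by ring
  · intro j hj
    exact if_neg (not_le.2 (Finset.mem_range.1 hj))

theorem geometricDist_apply_toReal {p : ℝ} (hp0 : 0 < p) (hp1 : p < 1) (k : ℕ+) :
    (geometricDist p hp0 hp1 k).toReal = p * (1 - p) ^ k.natPred :=
  ENNReal.toReal_ofReal (mul_nonneg hp0.le (pow_nonneg (by linarith) _))

theorem geometricDist_apply_toReal_le {p : ℝ} (hp0 : 0 < p) (hp1 : p < 1) (k : ℕ+) :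
    (geometricDist p hp0 hp1 k).toReal ≤ (1 - p) ^ k.natPred := by
  rw [geometricDist_apply_toReal]
  exact mul_le_of_le_one_left (pow_nonneg (by linarith) _) hp1.le

theorem finiteEntropy_geometricDist {p : ℝ} (hp0 : 0 < p) (hp1 : p < 1) :
    FiniteEntropy (geometricDist p hp0 hp1) := by
  have hq0 : 0 < 1 - p := by linarith
  have h₁ := summable_pow_mul_geometric_of_norm_lt_one (r := 1 - p) 1
    (by rw [Real.norm_of_nonneg hq0.le]; linarith)
  have h₂ := summable_geometric_of_lt_one hq0.le (by linarith : 1 - p < 1)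
  refine (summable_comp_natPred ((h₁.mul_left (-p * Real.log (1 - p))).add
    (h₂.mul_left (-p * Real.log p)))).congr fun k => ?_
  rw [geometricDist_apply_toReal, Real.negMulLog, Real.log_mul hp0.ne' (by positivity),
    Real.log_pow]
  ring

theorem logb_natCast_le_self (k : ℕ+) : Real.logb 2 (k : ℝ) ≤ k := by
  have h : (k : ℕ) < 2 ^ (k : ℕ) := Nat.lt_two_pow_self
  rw [Real.logb_le_iff_le_rpow one_lt_two (by exact_mod_cast k.pos), Real.rpow_natCast]
  exact_mod_cast h.le

theorem integral_escapeCost_geometricDist_le {p : ℝ} (hp0 : 0 < p) (hp1 : p < 1) (m : ℕ) :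
    ∫ k, escapeCost m k ∂(geometricDist p hp0 hp1).toMeasure ≤
      7 * ((1 - p) ^ m * (m + 1) * ∑' j : ℕ, (1 - p) ^ j * ((j : ℝ) + 1)) := by
  have hq0 : 0 < 1 - p := by linarith
  have hlog := (finiteEntropy_geometricDist hp0 hp1).summable_mul_logb
    (geometricDist_mem_monotonicDistributions p hp0 hp1)
  have hi := integrable_escapeCost hlog m
  have hs := (PMF.integrable_iff_summable _ _).1 hi
  obtain ⟨hs', hv'⟩ := tsum_tail_pow_mul_succ_le hq0 (by linarith : 1 - p < 1) m
  rw [PMF.integral_eq_tsum _ _ hi]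
  refine le_trans ?_ (mul_le_mul_of_nonneg_left hv' (by norm_num : (0 : ℝ) ≤ 7))
  rw [← tsum_mul_left]
  refine hs.tsum_le_tsum (fun k => ?_) (hs'.mul_left 7)
  have hk : (1 : ℝ) ≤ k := by exact_mod_cast one_le (a := k)
  rw [escapeCost]
  split_ifs
  · have h₁ : 3 * Real.logb 2 (k : ℝ) + 4 ≤ 7 * k := by linarith [logb_natCast_le_self k]
    have h₂ := geometricDist_apply_toReal_le hp0 hp1 k
    calc _ ≤ (geometricDist p hp0 hp1 k).toReal * (7 * k) :=
          mul_le_mul_of_nonneg_left h₁ ENNReal.toReal_nonneg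
      _ ≤ (1 - p) ^ k.natPred * (7 * k) := by gcongr
      _ = _ := by ring
  · simp

theorem map_letter_castSucc {m : ℕ} (θ : PMF ℕ+) (j : Fin m) :
    (θ.map (letter m)) j.castSucc = θ (Nat.succPNat j) := by
  classical
  have hj : j.castSucc = letter m (Nat.succPNat j) := by
    simp [letter, Fin.ext_iff, j.2.le]
  rw [PMF.map_apply, tsum_eq_single (Nat.succPNat j), if_pos hj]
  intro k hk
  refine if_neg fun h => hk (letter_injOn (hj.symm.trans h) ?_).symm
  rw [Nat.natPred_succPNat]
  exact j.2

/-- The positive parts of an arithmetic progression of negative difference `-d`. -/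
theorem sum_max_sub_mul_le {L d : ℝ} (hL : 0 ≤ L) (hd : 0 < d) (m : ℕ) :
    ∑ j ∈ Finset.range m, max (L - j * d) 0 ≤ L + L ^ 2 / (2 * d) := by
  -- `max u 0 ^ 2 / 2` is a primitive of the positive part, so `max (u - d) 0` is at most the mean
  -- of the positive part over `[u - d, u]`. The right side telescopes, and the term `j = 0`
  -- accounts for the extra `L`.
  have hstep : ∀ u : ℝ, max (u - d) 0 ≤ max u 0 ^ 2 / (2 * d) - max (u - d) 0 ^ 2 / (2 * d) := by
    intro u
    rw [← sub_div, le_div_iff₀ (by positivity)]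
    rcases le_total (u - d) 0 with h | h
    · rw [max_eq_right h]
      nlinarith [sq_nonneg (max u 0)]
    · rw [max_eq_left h, max_eq_left (by linarith)]
      nlinarith
  have key : ∀ m : ℕ, ∑ j ∈ Finset.range (m + 1), max (L - j * d) 0 ≤
      L + L ^ 2 / (2 * d) - max (L - m * d) 0 ^ 2 / (2 * d) := by
    intro m
    induction m with
    | zero => simp [hL]
    | succ m ih =>
      rw [Finset.sum_range_succ]
      have h := hstep (L - m * d)
      have e : L - m * d - d = L - ((m + 1 : ℕ) : ℝ) * d := by push_cast; ring
      rw [e] at h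
      linarith
  refine le_trans ?_ ((key m).trans (sub_le_self _ (by positivity)))
  exact Finset.sum_le_sum_of_subset_of_nonneg (Finset.range_mono (Nat.le_succ m))
    fun _ _ _ => le_max_right _ _

/-- From `1 + x ≤ 2 max 1 x` with `x = n q ^ j`. -/
theorem logb_one_add_mul_pow_le {q : ℝ} (hq0 : 0 < q) {n : ℕ} (hn : 0 < n) (j : ℕ) {t : ℝ}
    (ht0 : 0 ≤ t) (ht : t ≤ q ^ j) :
    Real.logb 2 (1 + n * t) ≤ 1 + max (Real.logb 2 n - j * -Real.logb 2 q) 0 := by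
  have hn' : (0 : ℝ) < n := Nat.cast_pos.2 hn
  have hs : Real.logb 2 n - j * -Real.logb 2 q = Real.logb 2 (n * q ^ j) := by
    rw [Real.logb_mul hn'.ne' (by positivity), Real.logb_pow]; ring
  have hle : n * t ≤ n * q ^ j := by gcongr
  rw [hs]
  have hpos : 0 < 1 + n * t := by positivity
  rcases le_total (n * q ^ j) 1 with h | h
  · have h₁ := Real.logb_le_logb_of_le one_lt_two hpos (show 1 + n * t ≤ 2 by linarith)
    rw [Real.logb_self_eq_one one_lt_two] at h₁
    exact h₁.trans (le_add_of_nonneg_right (le_max_right _ _))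
  · have h₁ := Real.logb_le_logb_of_le one_lt_two hpos
      (show 1 + n * t ≤ 2 * (n * q ^ j) by linarith)
    rw [Real.logb_mul two_ne_zero (by positivity), Real.logb_self_eq_one one_lt_two] at h₁
    exact h₁.trans (add_le_add_right (le_max_left _ _) _)

theorem neg_logb_one_sub_pos {p : ℝ} (hp0 : 0 < p) (hp1 : p < 1) : 0 < -Real.logb 2 (1 - p) :=
  neg_pos.2 (Real.logb_neg one_lt_two (by linarith) (by linarith))

/-- The source of the leading constant. One `log n` comes from the first term of the progression,
the other from the merged letter, whose probability is bounded by `1` only. -/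
theorem sum_logb_letter_geometricDist_le {p : ℝ} (hp0 : 0 < p) (hp1 : p < 1) {n : ℕ} (hn : 0 < n)
    (m : ℕ) :
    ∑ j, Real.logb 2 (1 + n * (((geometricDist p hp0 hp1).map (letter m)) j).toReal) ≤
      Real.logb 2 n ^ 2 / (2 * -Real.logb 2 (1 - p)) + 2 * Real.logb 2 n + (m + 1) := by
  have hL : 0 ≤ Real.logb 2 n := Real.logb_nonneg one_lt_two (by exact_mod_cast hn)
  have h₁ := sum_max_sub_mul_le hL (neg_logb_one_sub_pos hp0 hp1) m
  have h₂ := logb_one_add_mul_le hn ENNReal.toReal_nonneg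
    (PMF.toReal_apply_le_one ((geometricDist p hp0 hp1).map (letter m)) (Fin.last m))
  have h₃ : ∑ j : Fin m, Real.logb 2
      (1 + n * (((geometricDist p hp0 hp1).map (letter m)) j.castSucc).toReal) ≤
      m + ∑ j ∈ Finset.range m, max (Real.logb 2 n - j * -Real.logb 2 (1 - p)) 0 := by
    rw [← Fin.sum_univ_eq_sum_range fun j => max (Real.logb 2 n - j * -Real.logb 2 (1 - p)) 0]
    calc _ ≤ ∑ j : Fin m, (1 + max (Real.logb 2 n - (j : ℕ) * -Real.logb 2 (1 - p)) 0) := by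
          refine Finset.sum_le_sum fun j _ => ?_
          rw [map_letter_castSucc]
          refine logb_one_add_mul_pow_le (by linarith) hn j ENNReal.toReal_nonneg ?_
          simpa using geometricDist_apply_toReal_le hp0 hp1 (Nat.succPNat j)
      _ = _ := by rw [Finset.sum_add_distrib]; simp
  rw [Fin.sum_univ_castSucc]
  linarith

theorem natCast_mul_pow_le_one {q : ℝ} (hq0 : 0 < q) {n m : ℕ} (hn : 0 < n)
    (h : Real.logb 2 n ≤ m * -Real.logb 2 q) : n * q ^ m ≤ 1 := by
  have hn' : (0 : ℝ) < n := Nat.cast_pos.2 hn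
  rw [← Real.logb_nonpos_iff one_lt_two (by positivity), Real.logb_mul hn'.ne' (by positivity),
    Real.logb_pow]
  linarith

theorem tendsto_logb_natCast_atTop : Tendsto (fun n : ℕ => Real.logb 2 (n : ℝ)) atTop atTop :=
  (Real.tendsto_logb_atTop one_lt_two).comp tendsto_natCast_atTop_atTop

theorem redundancy_geometricDist_le {p : ℝ} (hp0 : 0 < p) (hp1 : p < 1) {ε : ℝ} (hε : 0 < ε) :
    ∀ᶠ n : ℕ in atTop, (monotonicCode n).redundancy (geometricDist p hp0 hp1) ≤
      (1 + ε) / (-2 * Real.logb 2 (1 - p)) * ((Real.logb 2 (n : ℝ)) ^ 2 / (n : ℝ)) := by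
  have hq0 : 0 < 1 - p := by linarith
  have hd := neg_logb_one_sub_pos hp0 hp1
  set d : ℝ := -Real.logb 2 (1 - p)
  set D : ℝ := ∑' j : ℕ, (1 - p) ^ j * ((j : ℝ) + 1)
  have hD : 0 ≤ D := tsum_nonneg fun j => by positivity
  have hθ := finiteEntropy_geometricDist hp0 hp1
  have hlog := hθ.summable_mul_logb (geometricDist_mem_monotonicDistributions p hp0 hp1)
  set K : ℝ := 20 + 14 * D
  have hK : 0 < K := by positivity
  -- The `8` combines the `2 d` of the target with `b ^ 2 ≤ 4 L ^ 2`.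
  have hη : 0 < ε / (8 * d * K) := by positivity
  have h₁ : ∀ᶠ n : ℕ in atTop, (bitLength (bitLength n) : ℝ) ^ 3 / bitLength n < ε / (8 * d * K) :=
    (tendsto_bitLength_pow_div.comp tendsto_bitLength_atTop).eventually (gt_mem_nhds hη)
  -- This pushes the cutoff past `(log n) / d`, hence `n (1 - p) ^ cutoff n ≤ 1`.
  have h₂ : ∀ᶠ n : ℕ in atTop, 1 / d ≤ bitLength (bitLength n) :=
    (tendsto_natCast_atTop_atTop.comp
      (tendsto_bitLength_atTop.comp tendsto_bitLength_atTop)).eventually_ge_atTop _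
  have h₃ : ∀ᶠ n : ℕ in atTop, 1 ≤ Real.logb 2 (n : ℝ) :=
    tendsto_logb_natCast_atTop.eventually_ge_atTop 1
  filter_upwards [h₁, h₂, h₃, eventually_gt_atTop 0] with n hn₁ hn₂ hL hn
  have hn' : (0 : ℝ) < n := Nat.cast_pos.2 hn
  have hb := bitLength_le_logb hn
  have hLb := logb_le_bitLength hn
  have ht1 : (1 : ℝ) ≤ (bitLength (bitLength n) : ℕ) := by
    exact_mod_cast one_le_bitLength (bitLength n)
  have hcut : (cutoff n : ℝ) = bitLength n * bitLength (bitLength n) := by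
    rw [cutoff, Nat.cast_mul]
  have hsum := sum_logb_letter_geometricDist_le hp0 hp1 hn (cutoff n)
  have hesc := integral_escapeCost_geometricDist_le hp0 hp1 (cutoff n)
  have hred := redundancy_typeCode_le hθ hlog hn (cutoff n)
  have hpow : n * (1 - p) ^ cutoff n ≤ 1 := by
    refine natCast_mul_pow_le_one hq0 hn (hLb.trans ?_)
    rw [hcut, mul_assoc]
    rw [div_le_iff₀ hd] at hn₂
    exact le_mul_of_one_le_right (Nat.cast_nonneg _) hn₂
  generalize (cutoff n : ℝ) = m at *
  generalize (bitLength (bitLength n) : ℝ) = t at *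
  generalize (bitLength n : ℝ) = b at *
  set L := Real.logb 2 (n : ℝ)
  have hb0 : 1 ≤ b := hL.trans hLb
  have hm0 : 1 ≤ m := by rw [hcut]; nlinarith
  have hm1 : m + 1 ≤ 2 * (b * t) := by linarith
  have hesc' : n * ∫ k, escapeCost (cutoff n) k ∂(geometricDist p hp0 hp1).toMeasure ≤
      7 * D * (m + 1) := by
    calc _ ≤ n * (7 * ((1 - p) ^ cutoff n * (m + 1) * D)) := by gcongr
      _ = n * (1 - p) ^ cutoff n * (7 * D * (m + 1)) := by ring
      _ ≤ 1 * (7 * D * (m + 1)) := by gcongr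
      _ = _ := one_mul _
  have hrem : 2 * L + (m + 1) + (m + 1) * (4 + 2 * t) + 1 + 7 * D * (m + 1) ≤
      K * (b * t ^ 2) := by
    have e₁ : (m + 1) * (5 + 2 * t + 7 * D) ≤ 2 * (b * t) * (7 * t + 7 * D * t) := by
      have : 7 * D ≤ 7 * D * t := le_mul_of_one_le_right (by positivity) ht1
      apply mul_le_mul hm1 (by linarith) (by positivity) (by positivity)
    have e₂ : b ≤ b * t ^ 2 := le_mul_of_one_le_right (by linarith) (one_le_pow₀ ht1)
    have e₃ : 2 * (b * t) * (7 * t + 7 * D * t) = (14 + 14 * D) * (b * t ^ 2) := by ring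
    have e₄ : K * (b * t ^ 2) = (14 + 14 * D) * (b * t ^ 2) + 6 * (b * t ^ 2) := by
      simp only [K]; ring
    linarith
  have hsmall : K * (b * t ^ 2) ≤ ε * L ^ 2 / (2 * d) := by
    have e₁ : t ^ 2 ≤ t ^ 3 := pow_le_pow_right₀ ht1 (by norm_num)
    rw [div_lt_iff₀ (by linarith)] at hn₁
    have e₂ : b ^ 2 ≤ 4 * L ^ 2 := by nlinarith
    calc K * (b * t ^ 2) ≤ K * (b * (ε / (8 * d * K) * b)) := by
          gcongr; exact e₁.trans hn₁.le
      _ = ε / (8 * d) * b ^ 2 := by field_simp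
      _ ≤ ε / (8 * d) * (4 * L ^ 2) := by gcongr
      _ = ε * L ^ 2 / (2 * d) := by field_simp; norm_num
  have hfinal : (1 + ε) / (-2 * Real.logb 2 (1 - p)) * (L ^ 2 / n) =
      (L ^ 2 / (2 * d) + ε * L ^ 2 / (2 * d)) / n := by
    have : -2 * Real.logb 2 (1 - p) = 2 * d := by simp only [d]; ring
    rw [this]
    field_simp
  rw [hfinal]
  refine hred.trans ?_
  rw [le_div_iff₀ hn', add_mul, div_mul_cancel₀ _ hn'.ne']
  linarith

/-! ### Effective alphabet size -/

theorem isLittleO_logb_natCast_rpow {r : ℝ} (hr : 0 < r) (d : ℝ) :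
    (fun n : ℕ => Real.logb 2 (n : ℝ) / d) =o[atTop] fun n : ℕ => (n : ℝ) ^ r := by
  have h := ((isLittleO_log_rpow_atTop hr).comp_tendsto
    tendsto_natCast_atTop_atTop).const_mul_left (Real.log 2 * d)⁻¹
  refine h.congr_left fun n => ?_
  simp only [Function.comp, Real.logb, mul_inv]
  ring

/-- The cost of the symbols of a geometric distribution beyond `m`, where `n (1 - p) ^ m = 1`. -/
theorem tsum_tail_mul_logb_le {p : ℝ} (hp0 : 0 < p) (hp1 : p < 1) {n : ℕ} (hn : 0 < n) {m : ℝ}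
    (hm0 : 0 ≤ m) (hm : Real.logb 2 (n : ℝ) = m * -Real.logb 2 (1 - p)) :
    0 ≤ ∑' i : {i : ℕ+ // m < (i : ℝ)},
      (n : ℝ) * (geometricDist p hp0 hp1 i.1).toReal * Real.logb 2 (i.1 : ℝ) ∧
    ∑' i : {i : ℕ+ // m < (i : ℝ)},
      (n : ℝ) * (geometricDist p hp0 hp1 i.1).toReal * Real.logb 2 (i.1 : ℝ) ≤
      (∑' j : ℕ, (1 - p) ^ j * ((j : ℝ) + 1)) / (1 - p) * (m + 1) := by
  have hq0 : 0 < 1 - p := by linarith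
  have hq1 : 1 - p < 1 := by linarith
  have hd := neg_logb_one_sub_pos hp0 hp1
  have hn' : (0 : ℝ) < n := Nat.cast_pos.2 hn
  have hD : 0 ≤ ∑' j : ℕ, (1 - p) ^ j * ((j : ℝ) + 1) := tsum_nonneg fun j => by positivity
  -- Symbols above `m` have `natPred` at least `M`, but only `n (1 - p) ^ (M + 1)` is known to be at
  -- most `1`; the lost power is the factor `1 / (1 - p)`.
  set M : ℕ := ⌊m⌋₊
  have hMm : (M : ℝ) ≤ m := Nat.floor_le hm0
  have hpow : n * (1 - p) ^ (M + 1) ≤ 1 := by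
    refine natCast_mul_pow_le_one hq0 hn ?_
    have h := (Nat.lt_floor_add_one m).le
    rw [hm]
    exact (mul_le_mul_of_nonneg_right h hd.le).trans_eq (by push_cast; rfl)
  obtain ⟨hs, hv⟩ := tsum_tail_pow_mul_succ_le hq0 hq1 M
  generalize ∑' j : ℕ, (1 - p) ^ j * ((j : ℝ) + 1) = D at *
  set F : ℕ+ → ℝ := fun i =>
    (n : ℝ) * (geometricDist p hp0 hp1 i).toReal * Real.logb 2 (i : ℝ)
  have hF0 : ∀ i, 0 ≤ F i := fun i => by
    have : 0 ≤ Real.logb 2 (i : ℝ) :=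
      Real.logb_nonneg one_lt_two (by exact_mod_cast one_le (a := i))
    positivity
  have hle : ∀ i, Set.indicator {i : ℕ+ | m < (i : ℝ)} F i ≤
      n * (if M ≤ i.natPred then (1 - p) ^ i.natPred * (i : ℝ) else 0) := fun i => by
    by_cases hi : m < (i : ℝ)
    · have hMi : M ≤ i.natPred := by
        have h₁ : (M : ℝ) < (i : ℕ) := hMm.trans_lt hi
        have h₂ : M < (i : ℕ) := by exact_mod_cast h₁
        have h₃ := i.natPred_add_one
        omega
      rw [Set.indicator_of_mem (s := {i : ℕ+ | m < (i : ℝ)}) hi F, if_pos hMi]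
      calc F i = n * ((geometricDist p hp0 hp1 i).toReal * Real.logb 2 (i : ℝ)) := mul_assoc _ _ _
        _ ≤ n * ((1 - p) ^ i.natPred * (i : ℝ)) := by
          have h₁ := geometricDist_apply_toReal_le hp0 hp1 i
          have h₂ := logb_natCast_le_self i
          have h₃ : 0 ≤ Real.logb 2 (i : ℝ) :=
            Real.logb_nonneg one_lt_two (by exact_mod_cast one_le (a := i))
          gcongr
    · rw [Set.indicator_of_notMem (show i ∉ {i : ℕ+ | m < (i : ℝ)} from hi)]
      split_ifs <;> positivity
  have hind0 : ∀ i, 0 ≤ Set.indicator {i : ℕ+ | m < (i : ℝ)} F i := fun i =>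
    Set.indicator_nonneg (fun i _ => hF0 i) i
  have htail : ∑' i : {i : ℕ+ // m < (i : ℝ)}, F i.1 ≤ D / (1 - p) * (m + 1) := by
    rw [show ∑' i : {i : ℕ+ // m < (i : ℝ)}, F i.1 = ∑' i, Set.indicator {i : ℕ+ | m < (i : ℝ)} F i
      from tsum_subtype {i : ℕ+ | m < (i : ℝ)} F]
    calc _ ≤ ∑' i : ℕ+, n * (if M ≤ i.natPred then (1 - p) ^ i.natPred * (i : ℝ) else 0) :=
          (Summable.of_nonneg_of_le hind0 hle (hs.mul_left _)).tsum_le_tsum hle (hs.mul_left _)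
      _ ≤ n * ((1 - p) ^ M * (M + 1) * D) := by rw [tsum_mul_left]; gcongr
      _ = n * (1 - p) ^ (M + 1) * (D / (1 - p) * (M + 1)) := by rw [pow_succ]; field_simp
      _ ≤ 1 * (D / (1 - p) * (m + 1)) := by gcongr
      _ = _ := one_mul _
  exact ⟨tsum_nonneg fun i => hF0 i.1, htail⟩

/-- The tail is `O(m)`, whereas the budget is `(m - 1) / 2` times a logarithm that diverges because
`m = o(n^{1/3})`. -/
theorem isEffectiveAlphabetSize_geometricDist {p : ℝ} (hp0 : 0 < p) (hp1 : p < 1) :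
    IsEffectiveAlphabetSize (geometricDist p hp0 hp1)
      (fun n => Real.logb 2 (n : ℝ) / (-Real.logb 2 (1 - p))) := by
  have hq0 : 0 < 1 - p := by linarith
  have hq1 : 1 - p < 1 := by linarith
  have hd := neg_logb_one_sub_pos hp0 hp1
  have hlo := isLittleO_logb_natCast_rpow (by norm_num : (0 : ℝ) < 1 / 3) (-Real.logb 2 (1 - p))
  refine ⟨hlo, (finiteEntropy_geometricDist hp0 hp1).summable_mul_logb
    (geometricDist_mem_monotonicDistributions p hp0 hp1), ?_⟩
  set d : ℝ := -Real.logb 2 (1 - p)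
  set D : ℝ := ∑' j : ℕ, (1 - p) ^ j * ((j : ℝ) + 1)
  have hD : 0 ≤ D := tsum_nonneg fun j => by positivity
  have hm : Tendsto (fun n : ℕ => Real.logb 2 (n : ℝ) / d) atTop atTop :=
    tendsto_logb_natCast_atTop.atTop_div_const hd
  have hratio : Tendsto (fun n : ℕ => Real.logb 2 ((n : ℝ) / (Real.logb 2 (n : ℝ) / d) ^ 3))
      atTop atTop := by
    refine (Real.tendsto_logb_atTop one_lt_two).comp ?_
    have h := (hlo.tendsto_div_nhds_zero.pow 3)
    rw [zero_pow three_ne_zero] at h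
    have h' : Tendsto (fun n : ℕ => ((Real.logb 2 (n : ℝ) / d) / (n : ℝ) ^ (1 / 3 : ℝ)) ^ 3) atTop
        (𝓝[>] 0) := by
      refine tendsto_nhdsWithin_iff.2 ⟨h, ?_⟩
      filter_upwards [hm.eventually_gt_atTop 0, eventually_gt_atTop 0] with n h₁ h₂
      have : (0 : ℝ) < n := Nat.cast_pos.2 h₂
      exact pow_pos (div_pos h₁ (by positivity)) 3
    refine h'.inv_tendsto_nhdsGT_zero.congr fun n => ?_
    have hn : ((n : ℝ) ^ (1 / 3 : ℝ)) ^ 3 = n := by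
      rw [← Real.rpow_natCast, ← Real.rpow_mul (Nat.cast_nonneg n)]
      norm_num
    rw [Pi.inv_apply, div_pow, hn, inv_div]
  refine IsLittleO.of_bound fun c hc => ?_
  -- `m ≥ 2` gives `m + 1 ≤ 3 (m - 1)`; with the halving in the budget this makes the `6`.
  filter_upwards [hm.eventually_ge_atTop 2, hratio.eventually_ge_atTop (6 * D / ((1 - p) * c)),
    eventually_gt_atTop 0] with n hm2 hr hn
  obtain ⟨htail0, htail⟩ := tsum_tail_mul_logb_le hp0 hp1 hn (zero_le_two.trans hm2)
    (div_mul_cancel₀ (Real.logb 2 (n : ℝ)) hd.ne').symm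
  generalize Real.logb 2 (n : ℝ) / d = m at *
  have hr0 : 0 ≤ 6 * D / ((1 - p) * c) := by positivity
  rw [Real.norm_of_nonneg htail0,
    Real.norm_of_nonneg (mul_nonneg (by linarith) (hr0.trans hr))]
  refine htail.trans ?_
  calc D / (1 - p) * (m + 1) ≤ D / (1 - p) * (3 * (m - 1)) := by gcongr; linarith
    _ = c * ((m - 1) / 2 * (6 * D / ((1 - p) * c))) := by field_simp; ring
    _ ≤ c * ((m - 1) / 2 * Real.logb 2 ((n : ℝ) / m ^ 3)) := by
      have : 0 ≤ (m - 1) / 2 := by linarith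
      gcongr

theorem mainTheorem11 :
    ∃ C : ∀ n : ℕ, BlockCode n, IsUniversalMonotonic C ∧
      ∀ (p : ℝ) (hp0 : 0 < p) (hp1 : p < 1),
        FiniteEntropy (geometricDist p hp0 hp1) ∧
        (∀ n, (C n).FiniteMeanLength (geometricDist p hp0 hp1)) ∧
        (∀ ε : ℝ, 0 < ε → ∀ᶠ n : ℕ in atTop,
          (C n).redundancy (geometricDist p hp0 hp1) ≤
            (1 + ε) / (-2 * Real.logb 2 (1 - p)) * ((Real.logb 2 (n : ℝ)) ^ 2 / (n : ℝ))) ∧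
        IsEffectiveAlphabetSize (geometricDist p hp0 hp1)
          (fun n => Real.logb 2 (n : ℝ) / (-Real.logb 2 (1 - p))) ∧
        (fun n : ℕ => Real.logb 2 (n : ℝ) / (-Real.logb 2 (1 - p)))
          =O[atTop] fun n : ℕ => Real.logb 2 (n : ℝ) := by
  refine ⟨monotonicCode, isUniversalMonotonic_monotonicCode, fun p hp0 hp1 => ?_⟩
  have hθ := finiteEntropy_geometricDist hp0 hp1
  refine ⟨hθ, (isUniversalMonotonic_monotonicCode _
    (geometricDist_mem_monotonicDistributions p hp0 hp1) hθ).1,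
    fun ε hε => redundancy_geometricDist_le hp0 hp1 hε,
    isEffectiveAlphabetSize_geometricDist hp0 hp1, ?_⟩
  exact ((isBigO_refl (fun n : ℕ => Real.logb 2 (n : ℝ)) atTop).const_mul_left
    (-Real.logb 2 (1 - p))⁻¹).congr_left fun n => (div_eq_inv_mul _ _).symm
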